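/- **Model.** Let $\lambda_p,\mu,a,b,c>0$ with $\lambda_p<\mu$, let $\sigma\ge 0$, $S_p\in\mathbb R$, and put $\psi=(1+\sigma^2\mu^2)/2$. For $\lambda_s\ge 0$, $\beta\in[0,\infty]$, $\lambda=\lambda_p+\lambda_s<\mu$, the mean waiting times of the primary and the secondary class in the M/G/1 queue (mean service time $1/\mu$, variance $\sigma^2$) under delay dependent priority with weight ratio $\beta$ are, by Kleinrock's formulas (with $1/\infty=0$), $$W_p(\lambda_s,\beta)=\begin{cases}\dfrac{\lambda\psi\,(\mu-\lambda(1-\beta))}{\mu(\mu-\lambda)(\mu-\lambda_p(1-\beta))}&\beta\le 1\\[2ex]\dfrac{\lambda\psi}{(\mu-\lambda)(\mu-\lambda_s(1-1/\beta))}&\beta>1,\end{cases}\qquad W_s(\lambda_s,\beta)=\begin{cases}\dfrac{\lambda\psi}{(\mu-\lambda)(\mu-\lambda_p(1-\beta))}&\beta\le 1\\[2ex]\dfrac{\lambda\psi\,(\mu-\lambda(1-1/\beta))}{\mu(\mu-\lambda)(\mu-\lambda_s(1-1/\beta))}&\beta>1,\end{cases}$$ and for $\lambda\ge\mu$ both are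 taken to be $+\infty$. **Problem P0.** Maximize $\theta\lambda_s$ over $\lambda_s,\theta,S_s\ge 0$ and $\beta\in[0,\infty]$ subject to $W_p(\lambda_s,\beta)\le S_p$, $W_s(\lambda_s,\beta)\le S_s$, $\lambda_s\le\mu-\lambda_p$ and $\lambda_s\le a-b\theta-cS_s$. **Game.** The service provider, facing $\lambda_s$, chooses $\theta,S_s\ge 0$ and $\beta\in[0,\infty]$ subject to the same four constraints so as to maximize $\theta\lambda_s$. The user-set, facing $(\theta,S_s,\beta)$, chooses $\lambda_s\ge 0$ with $\lambda_s\le a-b\theta-cS_s$ so as to maximize $\lambda_s$. A Nash equilibrium is a point $(\lambda_s,\theta,S_s,\beta)$ at which each player's choice is an optimal one (in particular an admissible one) against the other's. **Algorithm.** Let $\phi_0=\mu-\lambda_p$, $\hat S_p=\lambda_p\psi/(\mu\phi_0)$, $$G(x)=2\mu x^3-[c\psi+\mu(a+4\phi_0)]x^2+2\phi_0[c\psi+\mu(a+\phi_0)]x-a\mu\phi_0^2+c\psi\lambda_p(\mu+\phi_0),$$ $$\tilde G(x)=2\mu x^3-[a\mu+c\psi+4\mu^2]x^2+2\mu[a\mu+c\psi+\mu^2]x-\mu[a\mu^2-c\psi\lambda_p],$$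 $$u(r)=\frac{\psi(\lambda_p+r)}{(\mu-r)(\mu-\lambda_p-r)},\qquad \ell(r)=\frac{\psi(\lambda_p+r)}{\mu\phi_0},\qquad \lambda^{(4)}=\frac{S_p(2\mu-\lambda_p)+\psi-\sqrt{(S_p\lambda_p+\psi)^2+4\mu\psi S_p}}{2S_p}.$$ 1. If $S_p\le\hat S_p$ or $\frac ac\le\frac{\lambda_p}{\mu^2}\psi$, stop without a solution. 2. If $\frac{\mu-\lambda_p}{\mu\lambda_p}\le\frac{a\lambda_p-c\psi}{2\mu\lambda_p^2+c\psi(\mu+\lambda_p)}$, put $J_\ell=\infty$. Otherwise let $r_3$ be the unique root of $\tilde G$ in $(0,\phi_0)$ and $J_\ell=u(r_3)$; if $S_p>J_\ell$, put $(\lambda_s^*,\beta^*)=(r_3,\infty)$ and go to step 5. 3. If $\frac ac\le\frac{\lambda_p(2\mu-\lambda_p)}{\mu(\mu-\lambda_p)^2}\psi$, put $(\lambda_s^*,\beta^*)=(\lambda^{(4)},\infty)$ and go to step 5. 4. Let $r_1$ be the unique root of $G$ in $(0,\phi_0)$, $\lambda_1=\lambda_p+r_1$, $I_\ell=\ell(r_1)$,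 $I_u=u(r_1)$. If $\hat S_p<S_p<I_\ell$, put $(\lambda_s^*,\beta^*)=(\mu\phi_0S_p/\psi-\lambda_p,\,0)$. If $I_\ell\le S_p<I_u$, put $\lambda_s^*=r_1$ and $$\beta^*=\begin{cases}\dfrac{(\mu-\lambda_1)(\mu S_p\phi_0-\psi\lambda_1)}{\psi\lambda_1^2-\mu S_p\lambda_p(\mu-\lambda_1)}&\text{if }S_p\le\dfrac{\psi\lambda_1}{\mu(\mu-\lambda_1)},\\[2ex]\dfrac{S_pr_1(\mu-\lambda_1)}{\psi\lambda_1-S_p(\mu-r_1)(\mu-\lambda_1)}&\text{otherwise.}\end{cases}$$ If $I_u\le S_p\le J_\ell$, put $(\lambda_s^*,\beta^*)=(\lambda^{(4)},\infty)$. 5. Put $S_s^*=W_s(\lambda_s^*,\beta^*)$ and $\theta^*=(a-cS_s^*-\lambda_s^*)/b$. **Theorem 3.** Suppose that $S_p>\hat S_p$ and $\frac ac>\frac{\lambda_p}{\mu^2}\psi$. Then the algorithm returns a point $(\lambda_s^*,\theta^*,S_s^*,\beta^*)$ (every root it calls for exists and is unique), this point is the unique optimal solution of P0, it is a Nash equilibrium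 of the game, and every Nash equilibrium $(\lambda_s,\theta,S_s,\beta)$ satisfies $\theta\lambda_s\le\theta^*\lambda_s^*$. -/

import Mathlib

open scoped ENNReal

/-- Data of the pricing model: a single-server queue with Poisson arrivals and general service
times, shared by a primary and a secondary class of customers. -/
structure PricingModel where
  /-- Arrival rate of the primary class. -/
  lamP : ℝ
  /-- Service rate: the mean service time is `1 / mu`. -/
  mu : ℝ
  /-- Standard deviation of the service time. -/
  sigma : ℝ
  /-- Maximal arrival rate offered by the market. -/
  a : ℝ
  /-- Sensitivity of the demand to the price. -/
  b : ℝ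
  /-- Sensitivity of the demand to the assured service level. -/
  c : ℝ
  /-- Bound on the mean waiting time promised to the primary class. -/
  Sp : ℝ

/-- A joint choice of both players: the user-set chooses `lamS`, the service provider chooses
the price `theta`, the assured service level `Ss` and the relative priority `beta`
(a number in `[0, ∞]`) of the secondary class. -/
@[ext]
structure Profile where
  lamS : ℝ
  theta : ℝ
  Ss : ℝ
  beta : ℝ≥0∞

namespace PricingModel

variable (P : PricingModel)

/-- `ψ = (1 + σ² μ²) / 2`. -/
noncomputable def psi : ℝ := (1 + P.sigma ^ 2 * P.mu ^ 2) / 2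

/-! ### Mean waiting times under delay dependent priorities

The formulas are Kleinrock's.  `beta` is the ratio of the weight of the secondary class to that
of the primary class: `0` and `∞` are the static priorities, and `(∞)⁻¹ = 0` below. -/

/-- Steady-state mean waiting time of the primary class, for a total load below capacity. -/
noncomputable def waitP (lamS : ℝ) (beta : ℝ≥0∞) : ℝ :=
  let lam := P.lamP + lamS
  if beta ≤ 1 then
    lam * P.psi * (P.mu - lam * (1 - beta.toReal)) /
      (P.mu * (P.mu - lam) * (P.mu - P.lamP * (1 - beta.toReal)))
  else
    lam * P.psi / ((P.mu - lam) * (P.mu - lamS * (1 - (beta⁻¹).toReal)))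

/-- Steady-state mean waiting time of the secondary class, for a total load below capacity. -/
noncomputable def waitS (lamS : ℝ) (beta : ℝ≥0∞) : ℝ :=
  let lam := P.lamP + lamS
  if beta ≤ 1 then
    lam * P.psi / ((P.mu - lam) * (P.mu - P.lamP * (1 - beta.toReal)))
  else
    lam * P.psi * (P.mu - lam * (1 - (beta⁻¹).toReal)) /
      (P.mu * (P.mu - lam) * (P.mu - lamS * (1 - (beta⁻¹).toReal)))

/-- Mean waiting time of the primary class; infinite if the queue has no steady state. -/
noncomputable def Wp (lamS : ℝ) (beta : ℝ≥0∞) : EReal :=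
  if P.lamP + lamS < P.mu then (P.waitP lamS beta : EReal) else ⊤

/-- Mean waiting time of the secondary class; infinite if the queue has no steady state. -/
noncomputable def Ws (lamS : ℝ) (beta : ℝ≥0∞) : EReal :=
  if P.lamP + lamS < P.mu then (P.waitS lamS beta : EReal) else ⊤

/-! ### The joint pricing and scheduling problem -/

/-- Revenue rate from the secondary class. -/
def revenue (x : Profile) : ℝ := x.theta * x.lamS

/-- Constraints of the joint pricing and scheduling problem. -/
structure Feasible (x : Profile) : Prop where
  primary_qos : P.Wp x.lamS x.beta ≤ (P.Sp : EReal)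
  secondary_qos : P.Ws x.lamS x.beta ≤ (x.Ss : EReal)
  stability : x.lamS ≤ P.mu - P.lamP
  demand : x.lamS ≤ P.a - P.b * x.theta - P.c * x.Ss
  lamS_nonneg : 0 ≤ x.lamS
  theta_nonneg : 0 ≤ x.theta
  Ss_nonneg : 0 ≤ x.Ss

/-- `x` is an optimal solution of the joint pricing and scheduling problem. -/
def IsSolution (x : Profile) : Prop :=
  P.Feasible x ∧ ∀ y, P.Feasible y → revenue y ≤ revenue x

/-! ### The constrained two-player game -/

/-- Strategies `(theta, Ss, beta)` that the service provider may use against the arrival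
rate `lamS`. -/
structure ProviderFeasible (lamS theta Ss : ℝ) (beta : ℝ≥0∞) : Prop where
  primary_qos : P.Wp lamS beta ≤ (P.Sp : EReal)
  secondary_qos : P.Ws lamS beta ≤ (Ss : EReal)
  stability : lamS ≤ P.mu - P.lamP
  demand : lamS ≤ P.a - P.b * theta - P.c * Ss
  theta_nonneg : 0 ≤ theta
  Ss_nonneg : 0 ≤ Ss

/-- Arrival rates that the user-set may use against the price `theta` and service level `Ss`. -/
def UserFeasible (theta Ss lamS : ℝ) : Prop :=
  0 ≤ lamS ∧ lamS ≤ P.a - P.b * theta - P.c * Ss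

/-- `(theta, Ss, beta)` maximizes the revenue of the service provider against `lamS`. -/
def IsProviderBestResponse (lamS theta Ss : ℝ) (beta : ℝ≥0∞) : Prop :=
  P.ProviderFeasible lamS theta Ss beta ∧
    ∀ theta' Ss' beta', P.ProviderFeasible lamS theta' Ss' beta' →
      theta' * lamS ≤ theta * lamS

/-- `lamS` is the largest arrival rate available to the user-set against `(theta, Ss)`. -/
def IsUserBestResponse (theta Ss lamS : ℝ) : Prop :=
  P.UserFeasible theta Ss lamS ∧ ∀ lamS', P.UserFeasible theta Ss lamS' → lamS' ≤ lamS

/-- Nash equilibrium of the constrained game: mutual best responses. -/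
def IsNash (x : Profile) : Prop :=
  P.IsProviderBestResponse x.lamS x.theta x.Ss x.beta ∧ P.IsUserBestResponse x.theta x.Ss x.lamS

/-! ### The finite-step algorithm -/

open Classical in
/-- The unique zero of `f` in the open interval `(l, u)`; `none` if it does not exist or is
not unique. -/
noncomputable def uniqueRoot (f : ℝ → ℝ) (l u : ℝ) : Option ℝ :=
  if h : ∃! x, x ∈ Set.Ioo l u ∧ f x = 0 then some h.choose else none

/-- The smallest service level that can be promised to the primary class on its own. -/
noncomputable def SpHat : ℝ := P.lamP * P.psi / (P.mu * (P.mu - P.lamP))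

/-- The cubic `G`, with `φ₀ = μ - λ_p`. -/
noncomputable def G (x : ℝ) : ℝ :=
  let phi := P.mu - P.lamP
  2 * P.mu * x ^ 3 - (P.c * P.psi + P.mu * (P.a + 4 * phi)) * x ^ 2
    + 2 * phi * (P.c * P.psi + P.mu * (P.a + phi)) * x
    - P.a * P.mu * phi ^ 2 + P.c * P.psi * P.lamP * (P.mu + phi)

/-- The cubic `G̃`. -/
noncomputable def Gtilde (x : ℝ) : ℝ :=
  2 * P.mu * x ^ 3 - (P.a * P.mu + P.c * P.psi + 4 * P.mu ^ 2) * x ^ 2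
    + 2 * P.mu * (P.a * P.mu + P.c * P.psi + P.mu ^ 2) * x
    - P.mu * (P.a * P.mu ^ 2 - P.c * P.psi * P.lamP)

/-- `ψ λ / ((μ - r) (μ - λ))` with `λ = λ_p + r`: gives `J_ℓ` and `I_u`. -/
noncomputable def upperLevel (r : ℝ) : ℝ :=
  P.psi * (P.lamP + r) / ((P.mu - r) * (P.mu - (P.lamP + r)))

/-- `ψ λ / (μ (μ - λ_p))` with `λ = λ_p + r`: gives `I_ℓ`. -/
noncomputable def lowerLevel (r : ℝ) : ℝ :=
  P.psi * (P.lamP + r) / (P.mu * (P.mu - P.lamP))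

/-- The admission rate assigned by the algorithm together with static priority to the secondary
class when the primary constraint is active. -/
noncomputable def rateStatic : ℝ :=
  (1 / (2 * P.Sp)) * (P.Sp * (2 * P.mu - P.lamP) + P.psi
    - Real.sqrt ((P.Sp * P.lamP + P.psi) ^ 2 + 4 * P.mu * P.psi * P.Sp))

/-- The priority assigned for `S_p ∈ [I_ℓ, I_u)`, where `r` is the root of `G`. -/
noncomputable def betaDynamic (r : ℝ) : ℝ :=
  let lam := P.lamP + r
  if P.Sp ≤ P.psi * lam / (P.mu * (P.mu - lam)) then
    (P.mu - lam) * (P.mu * P.Sp * (P.mu - P.lamP) - P.psi * lam) /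
      (P.psi * lam ^ 2 - P.mu * P.Sp * P.lamP * (P.mu - lam))
  else
    P.Sp * r * (P.mu - lam) / (P.psi * lam - P.Sp * (P.mu - r) * (P.mu - lam))

/-- The part of the algorithm after `J_ℓ ∈ ℝ ∪ {∞}` has been computed and `S_p > J_ℓ` has been
excluded. -/
noncomputable def lateSteps (Jl : EReal) : Option (ℝ × ℝ≥0∞) :=
  if P.a / P.c ≤ P.lamP * (2 * P.mu - P.lamP) / (P.mu * (P.mu - P.lamP) ^ 2) * P.psi ∧
      P.SpHat < P.Sp ∧ (P.Sp : EReal) ≤ Jl then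
    some (P.rateStatic, ⊤)
  else
    match uniqueRoot P.G 0 (P.mu - P.lamP) with
    | none => none
    | some r =>
      if P.SpHat < P.Sp ∧ P.Sp < P.lowerLevel r then
        some (P.mu * (P.mu - P.lamP) * P.Sp / P.psi - P.lamP, 0)
      else if P.lowerLevel r ≤ P.Sp ∧ P.Sp < P.upperLevel r then
        some (r, ENNReal.ofReal (P.betaDynamic r))
      else if P.upperLevel r ≤ P.Sp ∧ (P.Sp : EReal) ≤ Jl then
        some (P.rateStatic, ⊤)
      else none

/-- The admission rate and the priority computed by the algorithm; `none` if it declares the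
data infeasible or cannot carry out one of its steps. -/
noncomputable def ratePriority : Option (ℝ × ℝ≥0∞) :=
  if P.Sp ≤ P.SpHat ∨ P.a / P.c ≤ P.lamP / P.mu ^ 2 * P.psi then
    none
  else if (P.mu - P.lamP) / (P.mu * P.lamP) ≤
      (P.a * P.lamP - P.c * P.psi) /
        (2 * P.mu * P.lamP ^ 2 + P.c * P.psi * (P.mu + P.lamP)) then
    P.lateSteps ⊤
  else
    match uniqueRoot P.Gtilde 0 (P.mu - P.lamP) with
    | none => none
    | some r =>
      if P.upperLevel r < P.Sp then some (r, ⊤)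
      else P.lateSteps (P.upperLevel r : EReal)

/-- The last step: from rate and priority to the assured service level `S_s = W_s(λ_s, β)` and
the price `θ = (a - c S_s - λ_s) / b`. -/
noncomputable def complete (z : ℝ × ℝ≥0∞) : Profile :=
  { lamS := z.1
    theta := (P.a - P.c * (P.Ws z.1 z.2).toReal - z.1) / P.b
    Ss := (P.Ws z.1 z.2).toReal
    beta := z.2 }

/-- Output `(λ_s, θ, S_s, β)` of the finite-step algorithm. -/
noncomputable def algorithm : Option Profile :=
  P.ratePriority.map P.complete

end PricingModel

/-!
Against a fixed rate `s` and priority `β`, the best the provider can do is to promise exactly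
`S_s = W_s` and to raise the price until the demand is exhausted. This leaves the problem of
maximizing `value s β = s (a - s - c W_s(s, β))`, which is `b` times the revenue, subject to
`W_p(s, β) ≤ S_p`.

By Kleinrock's conservation law (`conservation`) the sum `λ_p W_p + s W_s` does not depend on `β`,
so `value s β` is a function of `s` plus `c λ_p W_p(s, β)`. Hence the provider wants `W_p` as large
as possible, and `value s β` is bounded both by `valueActive s` (where `W_p = S_p`) and by
`valueStatic s` (where `β = ∞`). Both bounds are strictly concave in `s`; their derivatives are
`-G` and `-G̃` divided by positive factors (`valueActive_lt_tangent`, `valueStatic_lt_tangent`). The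
two bounds cross at `rateStatic`, where static priority meets the level `S_p`. The minimum of the
two bounds is therefore maximal at the root of `G̃`, at `rateStatic`, at the root of `G`, or at the
largest rate compatible with `W_p ≤ S_p`, which is served with `β = 0`. The tests of the algorithm
read off which case applies from signs of `G` and `G̃`, and `betaDynamic` solves `W_p = S_p` for `β`
at the root of `G`. Each branch thus returns a pair with the property `IsBest`
(`exists_ratePriority`).

Since `W_p` is strictly increasing in `β` for `s > 0` (`waitP_strictMono`), a best pair is unique;
since its value is positive (`IsBest.value_pos`), an optimal profile leaves no slack in `S_s` or in
the demand, and so is unique too. An optimal profile without slack in the demand is an equilibrium,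
and every equilibrium is feasible for the optimization problem, so it cannot earn more.
-/

namespace PricingModel

variable {P : PricingModel}

/-- The standing assumptions on the data: positive rates and sensitivities, a stable primary class,
a promise to the primary class that can be kept with slack in the absence of secondary customers,
and a market in which a small secondary class is profitable. -/
structure Viable (P : PricingModel) : Prop where
  lamP_pos : 0 < P.lamP
  lamP_lt_mu : P.lamP < P.mu
  b_pos : 0 < P.b
  c_pos : 0 < P.c
  SpHat_lt_Sp : P.SpHat < P.Sp
  profitable : P.lamP / P.mu ^ 2 * P.psi < P.a / P.c

lemma psi_pos : 0 < P.psi := by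
  unfold psi; positivity

lemma Viable.mu_pos (h : P.Viable) : 0 < P.mu := h.lamP_pos.trans h.lamP_lt_mu

lemma Viable.Sp_pos (h : P.Viable) : 0 < P.Sp := by
  refine lt_of_le_of_lt ?_ h.SpHat_lt_Sp
  have h1 := h.lamP_pos
  have h2 := h.mu_pos
  have h3 := sub_pos.2 h.lamP_lt_mu
  have h4 := P.psi_pos
  unfold SpHat
  positivity

/-! ### Mean waiting times as functions of the priority -/

lemma waitP_of_le_one {s : ℝ} {β : ℝ≥0∞} (hβ : β ≤ 1) :
    P.waitP s β = (P.lamP + s) * P.psi * (P.mu - (P.lamP + s) * (1 - β.toReal)) /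
      (P.mu * (P.mu - (P.lamP + s)) * (P.mu - P.lamP * (1 - β.toReal))) := by
  simp only [waitP, if_pos hβ]

lemma waitP_of_one_lt {s : ℝ} {β : ℝ≥0∞} (hβ : 1 < β) :
    P.waitP s β = (P.lamP + s) * P.psi /
      ((P.mu - (P.lamP + s)) * (P.mu - s * (1 - (β⁻¹).toReal))) := by
  simp only [waitP, if_neg hβ.not_ge]

lemma waitS_of_le_one {s : ℝ} {β : ℝ≥0∞} (hβ : β ≤ 1) :
    P.waitS s β = (P.lamP + s) * P.psi /
      ((P.mu - (P.lamP + s)) * (P.mu - P.lamP * (1 - β.toReal))) := by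
  simp only [waitS, if_pos hβ]

lemma waitS_of_one_lt {s : ℝ} {β : ℝ≥0∞} (hβ : 1 < β) :
    P.waitS s β = (P.lamP + s) * P.psi * (P.mu - (P.lamP + s) * (1 - (β⁻¹).toReal)) /
      (P.mu * (P.mu - (P.lamP + s)) * (P.mu - s * (1 - (β⁻¹).toReal))) := by
  simp only [waitS, if_neg hβ.not_ge]

lemma waitP_top (s : ℝ) : P.waitP s ⊤ = P.upperLevel s := by
  rw [waitP_of_one_lt (by simp), upperLevel]
  simp only [ENNReal.inv_top, ENNReal.toReal_zero]
  ring_nf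

lemma waitP_bot (h : P.Viable) {s : ℝ} (hs : P.lamP + s < P.mu) :
    P.waitP s 0 = P.lowerLevel s := by
  have h2 := h.mu_pos
  have h3 := sub_pos.2 h.lamP_lt_mu
  have h4 := sub_pos.2 hs
  rw [waitP_of_le_one (by simp), lowerLevel]
  simp only [ENNReal.toReal_zero, sub_zero, mul_one]
  field_simp

lemma toReal_mem_unit {β : ℝ≥0∞} (hβ : β ≤ 1) : 0 ≤ β.toReal ∧ β.toReal ≤ 1 :=
  ⟨ENNReal.toReal_nonneg, by simpa using ENNReal.toReal_mono ENNReal.one_ne_top hβ⟩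

lemma toReal_inv_mem_unit {β : ℝ≥0∞} (hβ : 1 < β) :
    0 ≤ (β⁻¹).toReal ∧ (β⁻¹).toReal < 1 := by
  refine ⟨ENNReal.toReal_nonneg, ?_⟩
  have := (ENNReal.toReal_lt_toReal (ENNReal.inv_ne_top.2 (zero_lt_one.trans hβ).ne')
    ENNReal.one_ne_top).2 (ENNReal.inv_lt_one.2 hβ)
  simpa using this

lemma sub_mul_pos {m l y : ℝ} (hl : 0 ≤ l) (hlm : l < m) (hy : y ≤ 1) : 0 < m - l * y := by
  nlinarith

/-- Kleinrock's conservation law: the load-weighted mean waiting time does not depend on the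
priority. -/
lemma conservation (h : P.Viable) {s : ℝ} (hs0 : 0 ≤ s) (hs : P.lamP + s < P.mu) (β : ℝ≥0∞) :
    P.lamP * P.waitP s β + s * P.waitS s β =
      P.psi * (P.lamP + s) ^ 2 / (P.mu * (P.mu - (P.lamP + s))) := by
  have h1 := h.lamP_pos
  have h2 := h.mu_pos
  have h4 := sub_pos.2 hs
  rcases le_or_gt β 1 with hβ | hβ
  · rw [waitP_of_le_one hβ, waitS_of_le_one hβ]
    have h5 := sub_mul_pos h1.le h.lamP_lt_mu (y := 1 - β.toReal)
      (by linarith [(toReal_mem_unit hβ).1])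
    field_simp
    ring
  · rw [waitP_of_one_lt hβ, waitS_of_one_lt hβ]
    have h5 := sub_mul_pos hs0 (by linarith : s < P.mu) (y := 1 - (β⁻¹).toReal)
      (by linarith [(toReal_inv_mem_unit hβ).1])
    field_simp
    ring

lemma waitS_nonneg (h : P.Viable) {s : ℝ} (hs0 : 0 ≤ s) (hs : P.lamP + s < P.mu) (β : ℝ≥0∞) :
    0 ≤ P.waitS s β := by
  have h1 := h.lamP_pos
  have h2 := h.mu_pos
  have h4 := sub_pos.2 hs
  have hψ := P.psi_pos
  rcases le_or_gt β 1 with hβ | hβ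
  · rw [waitS_of_le_one hβ]
    have h5 := sub_mul_pos h1.le h.lamP_lt_mu (y := 1 - β.toReal)
      (by linarith [(toReal_mem_unit hβ).1])
    positivity
  · rw [waitS_of_one_lt hβ]
    have hy : 1 - (β⁻¹).toReal ≤ 1 := by linarith [(toReal_inv_mem_unit hβ).1]
    have h5 := sub_mul_pos hs0 (by linarith : s < P.mu) hy
    have h6 := sub_mul_pos (by linarith : 0 ≤ P.lamP + s) hs hy
    positivity

/-- Raising the priority of a nonempty secondary class strictly delays the primary class. -/
lemma waitP_strictMono (h : P.Viable) {s : ℝ} (hs0 : 0 < s) (hs : P.lamP + s < P.mu) :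
    StrictMono (P.waitP s) := by
  have h1 := h.lamP_pos
  have h2 := h.mu_pos
  have h4 := sub_pos.2 hs
  have hψ := P.psi_pos
  intro β β' hlt
  rcases le_or_gt β 1 with hβ | hβ
  · obtain ⟨hx0, hx1⟩ := toReal_mem_unit hβ
    have h5 := sub_mul_pos h1.le h.lamP_lt_mu (y := 1 - β.toReal) (by linarith)
    rcases le_or_gt β' 1 with hβ' | hβ'
    · obtain ⟨hx0', hx1'⟩ := toReal_mem_unit hβ'
      have h6 := sub_mul_pos h1.le h.lamP_lt_mu (y := 1 - β'.toReal) (by linarith)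
      have hx : β.toReal < β'.toReal :=
        (ENNReal.toReal_lt_toReal hlt.ne_top (hβ'.trans_lt ENNReal.one_lt_top).ne).2 hlt
      rw [waitP_of_le_one hβ, waitP_of_le_one hβ', mul_div_mul_comm ((P.lamP + s) * P.psi),
        mul_div_mul_comm ((P.lamP + s) * P.psi)]
      have hC : 0 < (P.lamP + s) * P.psi / (P.mu * (P.mu - (P.lamP + s))) := by positivity
      refine mul_lt_mul_of_pos_left ?_ hC
      rw [div_lt_div_iff₀ h5 h6]
      nlinarith [mul_pos (mul_pos h2 hs0) (sub_pos.2 hx)]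
    · -- Both sides are compared with the waiting time at `β = 1`.
      obtain ⟨hx0', hx1'⟩ := toReal_inv_mem_unit hβ'
      have h6 := sub_mul_pos hs0.le (by linarith : s < P.mu) (y := 1 - (β'⁻¹).toReal)
        (by linarith)
      calc P.waitP s β ≤ (P.lamP + s) * P.psi / ((P.mu - (P.lamP + s)) * P.mu) := by
            rw [waitP_of_le_one hβ, mul_div_mul_comm, mul_comm (P.mu - _) P.mu]
            refine mul_le_of_le_one_right (by positivity) ?_
            rw [div_le_one h5]
            nlinarith [mul_nonneg hs0.le (sub_nonneg.2 hx1)]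
        _ < P.waitP s β' := by
            rw [waitP_of_one_lt hβ']
            refine div_lt_div_of_pos_left (by positivity) (by positivity) ?_
            refine mul_lt_mul_of_pos_left ?_ h4
            nlinarith [mul_pos hs0 (sub_pos.2 hx1')]
  · have hβ' := hβ.trans hlt
    have hx : (β'⁻¹).toReal < (β⁻¹).toReal :=
      (ENNReal.toReal_lt_toReal (ENNReal.inv_ne_top.2 (zero_lt_one.trans hβ').ne')
        (ENNReal.inv_ne_top.2 (zero_lt_one.trans hβ).ne')).2 (ENNReal.inv_lt_inv.2 hlt)
    have h6 := sub_mul_pos hs0.le (by linarith : s < P.mu) (y := 1 - (β'⁻¹).toReal)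
      (by linarith [(toReal_inv_mem_unit hβ').1])
    rw [waitP_of_one_lt hβ, waitP_of_one_lt hβ']
    refine div_lt_div_of_pos_left (by positivity) (by positivity) ?_
    refine mul_lt_mul_of_pos_left ?_ h4
    nlinarith [mul_pos hs0 (sub_pos.2 hx)]

lemma lowerLevel_le_waitP (h : P.Viable) {s : ℝ} (hs0 : 0 < s) (hs : P.lamP + s < P.mu)
    (β : ℝ≥0∞) : P.lowerLevel s ≤ P.waitP s β := by
  rw [← waitP_bot h hs]
  exact (waitP_strictMono h hs0 hs).monotone bot_le

lemma waitP_le_upperLevel (h : P.Viable) {s : ℝ} (hs0 : 0 < s) (hs : P.lamP + s < P.mu)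
    (β : ℝ≥0∞) : P.waitP s β ≤ P.upperLevel s := by
  rw [← waitP_top]
  exact (waitP_strictMono h hs0 hs).monotone le_top

lemma upperLevel_lt_upperLevel (h : P.Viable) {r s : ℝ} (hr0 : 0 ≤ r) (hrs : r < s)
    (hs : P.lamP + s < P.mu) : P.upperLevel r < P.upperLevel s := by
  have h1 := h.lamP_pos
  have hψ := P.psi_pos
  have h4 := sub_pos.2 hs
  have h5 : 0 < P.mu - s := by linarith
  have h6 : P.mu - s < P.mu - r := by linarith
  have hs0 : 0 < s := hr0.trans_lt hrs
  have h7 : P.mu - (P.lamP + s) < P.mu - (P.lamP + r) := by linarith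
  unfold upperLevel
  refine div_lt_div₀ (mul_lt_mul_of_pos_left (by linarith) hψ) ?_ (by positivity) (by positivity)
  exact (mul_lt_mul'' h6 h7 h5.le h4.le).le

lemma lowerLevel_strictMono (h : P.Viable) : StrictMono P.lowerLevel := by
  intro r s hrs
  have h2 := h.mu_pos
  have h3 := sub_pos.2 h.lamP_lt_mu
  unfold lowerLevel
  exact div_lt_div_of_pos_right (mul_lt_mul_of_pos_left (by linarith) P.psi_pos) (by positivity)

/-! ### Concave bounds for the revenue -/

/-- `b` times the revenue from the rate `s` with priority `β`, when the assured service level is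
the mean waiting time and the price exhausts the demand. -/
noncomputable def value (P : PricingModel) (s : ℝ) (β : ℝ≥0∞) : ℝ :=
  s * (P.a - s - P.c * P.waitS s β)

/-- What `value` would be if the mean waiting time of the primary class were equal to `S_p`. -/
noncomputable def valueActive (P : PricingModel) (s : ℝ) : ℝ :=
  s * (P.a - s) - P.c * (P.psi * (P.lamP + s) ^ 2 / (P.mu * (P.mu - (P.lamP + s))))
    + P.c * P.lamP * P.Sp

/-- `value` under static priority to the secondary class. -/
noncomputable def valueStatic (P : PricingModel) (s : ℝ) : ℝ :=
  s * (P.a - s) - P.c * (P.psi * s * (P.lamP + s) / (P.mu * (P.mu - s)))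

lemma value_eq_valueActive (h : P.Viable) {s : ℝ} (hs0 : 0 ≤ s) (hs : P.lamP + s < P.mu)
    (β : ℝ≥0∞) :
    P.value s β = P.valueActive s - P.c * P.lamP * (P.Sp - P.waitP s β) := by
  rw [value, valueActive, ← conservation h hs0 hs β]
  ring

lemma value_le_valueActive (h : P.Viable) {s : ℝ} (hs0 : 0 ≤ s) (hs : P.lamP + s < P.mu)
    {β : ℝ≥0∞} (hβ : P.waitP s β ≤ P.Sp) : P.value s β ≤ P.valueActive s := by
  rw [value_eq_valueActive h hs0 hs]
  have := mul_nonneg (mul_pos h.c_pos h.lamP_pos).le (sub_nonneg.2 hβ)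
  linarith

lemma value_top (h : P.Viable) {s : ℝ} (hs : P.lamP + s < P.mu) :
    P.value s ⊤ = P.valueStatic s := by
  have h1 := h.lamP_pos
  have h2 := h.mu_pos
  have h4 := sub_pos.2 hs
  have h5 : 0 < P.mu - s := by linarith
  rw [value, waitS_of_one_lt (by simp), valueStatic]
  simp only [ENNReal.inv_top, ENNReal.toReal_zero, sub_zero, mul_one]
  field_simp

lemma value_le_value (h : P.Viable) {s : ℝ} (hs0 : 0 ≤ s) (hs : P.lamP + s < P.mu)
    {β β' : ℝ≥0∞} (hβ : P.waitP s β ≤ P.waitP s β') : P.value s β ≤ P.value s β' := by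
  rw [value_eq_valueActive h hs0 hs, value_eq_valueActive h hs0 hs]
  have := mul_le_mul_of_nonneg_left hβ (mul_pos h.c_pos h.lamP_pos).le
  linarith

lemma value_le_valueStatic (h : P.Viable) {s : ℝ} (hs0 : 0 ≤ s) (hs : P.lamP + s < P.mu)
    (β : ℝ≥0∞) : P.value s β ≤ P.valueStatic s := by
  rcases hs0.eq_or_lt with rfl | hs0'
  · simp [value, valueStatic]
  · rw [← value_top h hs]
    refine value_le_value h hs0 hs ?_
    rw [waitP_top]
    exact waitP_le_upperLevel h hs0' hs β

/-- Strict concavity of `valueActive`, with its derivative written in terms of `G`. -/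
lemma valueActive_lt_tangent (h : P.Viable) {r s : ℝ} (hr : P.lamP + r < P.mu)
    (hs : P.lamP + s < P.mu) (hne : r ≠ s) :
    P.valueActive r <
      P.valueActive s - (r - s) * (P.G s / (P.mu * (P.mu - (P.lamP + s)) ^ 2)) := by
  have h2 := h.mu_pos
  have hr' := sub_pos.2 hr
  have hs' := sub_pos.2 hs
  have hc := h.c_pos
  have hψ := P.psi_pos
  have hd : 0 < (r - s) ^ 2 := by have := sub_ne_zero.2 hne; positivity
  have key : P.valueActive s - (r - s) * (P.G s / (P.mu * (P.mu - (P.lamP + s)) ^ 2))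
      - P.valueActive r = (r - s) ^ 2 * (1 + P.c * P.psi * P.mu /
        ((P.mu - (P.lamP + r)) * (P.mu - (P.lamP + s)) ^ 2)) := by
    unfold valueActive G
    field_simp
    ring
  have : 0 < (r - s) ^ 2 * (1 + P.c * P.psi * P.mu /
      ((P.mu - (P.lamP + r)) * (P.mu - (P.lamP + s)) ^ 2)) := by positivity
  linarith

/-- Strict concavity of `valueStatic`, with its derivative written in terms of `G̃`. -/
lemma valueStatic_lt_tangent (h : P.Viable) {r s : ℝ} (hr : r < P.mu) (hs : s < P.mu)
    (hne : r ≠ s) :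
    P.valueStatic r < P.valueStatic s - (r - s) * (P.Gtilde s / (P.mu * (P.mu - s) ^ 2)) := by
  have h1 := h.lamP_pos
  have h2 := h.mu_pos
  have hr' := sub_pos.2 hr
  have hs' := sub_pos.2 hs
  have hc := h.c_pos
  have hψ := P.psi_pos
  have hd : 0 < (r - s) ^ 2 := by have := sub_ne_zero.2 hne; positivity
  have key : P.valueStatic s - (r - s) * (P.Gtilde s / (P.mu * (P.mu - s) ^ 2))
      - P.valueStatic r = (r - s) ^ 2 * (1 + P.c * P.psi * (P.mu + P.lamP) /
        ((P.mu - r) * (P.mu - s) ^ 2)) := by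
    unfold valueStatic Gtilde
    field_simp
    ring
  have : 0 < (r - s) ^ 2 * (1 + P.c * P.psi * (P.mu + P.lamP) /
        ((P.mu - r) * (P.mu - s) ^ 2)) := by positivity
  linarith

lemma valueActive_lt (h : P.Viable) {r s : ℝ} (hr : P.lamP + r < P.mu) (hs : P.lamP + s < P.mu)
    (hne : r ≠ s) (hG : 0 ≤ (r - s) * P.G s) : P.valueActive r < P.valueActive s := by
  have h2 := h.mu_pos
  have hs' := sub_pos.2 hs
  refine (valueActive_lt_tangent h hr hs hne).trans_le ?_
  rw [← mul_div_assoc]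
  have : 0 ≤ (r - s) * P.G s / (P.mu * (P.mu - (P.lamP + s)) ^ 2) := by positivity
  linarith

lemma valueStatic_lt (h : P.Viable) {r s : ℝ} (hr : r < P.mu) (hs : s < P.mu)
    (hne : r ≠ s) (hG : 0 ≤ (r - s) * P.Gtilde s) : P.valueStatic r < P.valueStatic s := by
  have h2 := h.mu_pos
  have hs' := sub_pos.2 hs
  refine (valueStatic_lt_tangent h hr hs hne).trans_le ?_
  rw [← mul_div_assoc]
  have : 0 ≤ (r - s) * P.Gtilde s / (P.mu * (P.mu - s) ^ 2) := by positivity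
  linarith

/-- `G` changes sign at most once: two sign conditions to the contrary would make each of
`valueActive r`, `valueActive s` smaller than the other. -/
lemma G_pos_of_lt (h : P.Viable) {r s : ℝ} (hrs : r < s) (hs : P.lamP + s < P.mu)
    (hG : 0 ≤ P.G r) : 0 < P.G s := by
  by_contra! hGs
  have h1 := valueActive_lt h (r := r) (by linarith) hs hrs.ne
    (mul_nonneg_of_nonpos_of_nonpos (by linarith) hGs)
  have h2 := valueActive_lt h hs (s := r) (by linarith) hrs.ne'
    (mul_nonneg (by linarith) hG)
  exact h1.not_gt h2

lemma Gtilde_pos_of_lt (h : P.Viable) {r s : ℝ} (hrs : r < s) (hs : s < P.mu)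
    (hG : 0 ≤ P.Gtilde r) : 0 < P.Gtilde s := by
  by_contra! hGs
  have h1 := valueStatic_lt h (r := r) (by linarith) hs hrs.ne
    (mul_nonneg_of_nonpos_of_nonpos (by linarith) hGs)
  have h2 := valueStatic_lt h hs (s := r) (by linarith) hrs.ne'
    (mul_nonneg (by linarith) hG)
  exact h1.not_gt h2

/-! ### Roots of the two cubics -/

lemma uniqueRoot_eq_some {f : ℝ → ℝ} {l u : ℝ} (h : ∃! x, x ∈ Set.Ioo l u ∧ f x = 0) :
    ∃ r ∈ Set.Ioo l u, f r = 0 ∧ uniqueRoot f l u = some r :=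
  ⟨h.choose, h.choose_spec.1.1, h.choose_spec.1.2, by rw [uniqueRoot, dif_pos h]⟩

/-- A continuous function that rises from a negative to a positive value and stays positive
after its zeros has exactly one zero. -/
lemma existsUnique_root {f : ℝ → ℝ} {l u : ℝ} (hf : Continuous f) (hlu : l ≤ u) (hl : f l < 0)
    (hu : 0 < f u) (hmono : ∀ r s, r < s → s < u → 0 ≤ f r → 0 < f s) :
    ∃! x, x ∈ Set.Ioo l u ∧ f x = 0 := by
  obtain ⟨x, hx, hfx⟩ := intermediate_value_Ioo hlu hf.continuousOn ⟨hl, hu⟩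
  refine ⟨x, ⟨hx, hfx⟩, fun y ⟨hy, hfy⟩ ↦ ?_⟩
  rcases lt_trichotomy y x with hyx | hyx | hyx
  · exact absurd hfx (hmono y x hyx hx.2 hfy.ge).ne'
  · exact hyx
  · exact absurd hfy (hmono x y hyx hy.2 hfx.ge).ne'

lemma Gtilde_zero_neg (h : P.Viable) : P.Gtilde 0 < 0 := by
  have h2 := h.mu_pos
  have hp := h.profitable
  rw [div_mul_eq_mul_div, div_lt_div_iff₀ (by positivity) h.c_pos] at hp
  have : P.Gtilde 0 = P.mu * (P.lamP * P.psi * P.c - P.a * P.mu ^ 2) := by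
    unfold Gtilde; ring
  rw [this]
  exact mul_neg_of_pos_of_neg h2 (by linarith)

/-- The test for `J_ℓ = ∞` is the sign of `G̃` at the capacity left to the secondary class. -/
lemma capacity_test_iff (h : P.Viable) :
    (P.mu - P.lamP) / (P.mu * P.lamP) ≤
      (P.a * P.lamP - P.c * P.psi) /
        (2 * P.mu * P.lamP ^ 2 + P.c * P.psi * (P.mu + P.lamP)) ↔
    P.Gtilde (P.mu - P.lamP) ≤ 0 := by
  have h1 := h.lamP_pos
  have h2 := h.mu_pos
  have hc := h.c_pos
  have hψ := P.psi_pos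
  rw [div_le_div_iff₀ (by positivity) (by positivity)]
  have : P.Gtilde (P.mu - P.lamP) =
      (P.mu - P.lamP) * (2 * P.mu * P.lamP ^ 2 + P.c * P.psi * (P.mu + P.lamP))
        - (P.a * P.lamP - P.c * P.psi) * (P.mu * P.lamP) := by
    unfold Gtilde; ring
  rw [this, sub_nonpos]

lemma exists_root_Gtilde (h : P.Viable) (hG : 0 < P.Gtilde (P.mu - P.lamP)) :
    ∃ r ∈ Set.Ioo 0 (P.mu - P.lamP), P.Gtilde r = 0 ∧
      uniqueRoot P.Gtilde 0 (P.mu - P.lamP) = some r := by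
  refine uniqueRoot_eq_some (existsUnique_root ?_ (sub_pos.2 h.lamP_lt_mu).le
    (Gtilde_zero_neg h) hG ?_)
  · unfold Gtilde; fun_prop
  · intro r s hrs hs
    exact Gtilde_pos_of_lt h hrs (by linarith [h.lamP_pos])

lemma rate_test_iff (h : P.Viable) :
    P.a / P.c ≤ P.lamP * (2 * P.mu - P.lamP) / (P.mu * (P.mu - P.lamP) ^ 2) * P.psi ↔
      0 ≤ P.G 0 := by
  have h2 := h.mu_pos
  have h3 := sub_pos.2 h.lamP_lt_mu
  rw [div_mul_eq_mul_div, div_le_div_iff₀ h.c_pos (by positivity), ← sub_nonneg]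
  have : P.G 0 = P.lamP * (2 * P.mu - P.lamP) * P.psi * P.c
      - P.a * (P.mu * (P.mu - P.lamP) ^ 2) := by
    unfold G; ring
  rw [this]

lemma exists_root_G (h : P.Viable) (hG : P.G 0 < 0) :
    ∃ r ∈ Set.Ioo 0 (P.mu - P.lamP), P.G r = 0 ∧
      uniqueRoot P.G 0 (P.mu - P.lamP) = some r := by
  have h1 := h.lamP_pos
  have h2 := h.mu_pos
  have h3 := sub_pos.2 h.lamP_lt_mu
  have hc := h.c_pos
  have hψ := P.psi_pos
  refine uniqueRoot_eq_some (existsUnique_root ?_ h3.le hG ?_ ?_)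
  · unfold G; fun_prop
  · have : P.G (P.mu - P.lamP) = P.c * P.psi * P.mu ^ 2 := by
      unfold G; ring
    rw [this]; positivity
  · intro r s hrs hs
    exact G_pos_of_lt h hrs (by linarith)

/-! ### The rates and priorities assigned by the algorithm -/

/-- `rateStatic` is the smaller root of the quadratic `S_p (μ - r) (μ - λ_p - r) - ψ (λ_p + r)`,
which is positive at `0` and negative at `μ - λ_p`. -/
lemma rateStatic_spec (h : P.Viable) :
    0 < P.rateStatic ∧ P.lamP + P.rateStatic < P.mu ∧ P.upperLevel P.rateStatic = P.Sp := by
  have h1 := h.lamP_pos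
  have h2 := h.mu_pos
  have h3 := sub_pos.2 h.lamP_lt_mu
  have hψ := P.psi_pos
  have hS := h.Sp_pos
  have hSp := h.SpHat_lt_Sp
  rw [SpHat, div_lt_iff₀ (by positivity)] at hSp
  set D := (P.Sp * P.lamP + P.psi) ^ 2 + 4 * P.mu * P.psi * P.Sp with hD
  have hD0 : 0 ≤ D := by positivity
  set q := Real.sqrt D with hq
  have hq0 : 0 ≤ q := Real.sqrt_nonneg D
  have hqq : q ^ 2 = D := Real.sq_sqrt hD0
  set r := P.rateStatic with hr
  have hrq : 2 * P.Sp * r = P.Sp * (2 * P.mu - P.lamP) + P.psi - q := by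
    rw [hr, rateStatic, ← hD, ← hq]
    field_simp
  have hr0 : 0 < r := by
    have : q < P.Sp * (2 * P.mu - P.lamP) + P.psi := by
      refine lt_of_pow_lt_pow_left₀ 2 (by nlinarith) ?_
      rw [hqq, hD]
      nlinarith
    nlinarith
  have hr1 : P.lamP + r < P.mu := by
    have : P.Sp * P.lamP + P.psi < q := by
      refine lt_of_pow_lt_pow_left₀ 2 hq0 ?_
      rw [hqq, hD]
      have : 0 < 4 * P.mu * P.psi * P.Sp := by positivity
      linarith
    nlinarith
  refine ⟨hr0, hr1, ?_⟩
  rw [upperLevel, div_eq_iff (mul_pos (by linarith) (by linarith)).ne']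
  have hqr : q = P.Sp * (2 * P.mu - P.lamP) + P.psi - 2 * P.Sp * r := by linarith
  rw [hqr, hD] at hqq
  have : 4 * P.Sp * (P.psi * (P.lamP + r)
      - P.Sp * ((P.mu - r) * (P.mu - (P.lamP + r)))) = 0 := by
    linear_combination -hqq
  have := (mul_eq_zero.1 this).resolve_left (by positivity)
  linarith

/-- `betaDynamic` solves `W_p(r, β) = S_p` for `β`. -/
lemma waitP_betaDynamic (h : P.Viable) {r : ℝ} (hr0 : 0 < r) (hr : P.lamP + r < P.mu)
    (hl : P.lowerLevel r ≤ P.Sp) (hu : P.Sp < P.upperLevel r) :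
    P.waitP r (ENNReal.ofReal (P.betaDynamic r)) = P.Sp := by
  have h1 := h.lamP_pos
  have h2 := h.mu_pos
  have h3 := sub_pos.2 h.lamP_lt_mu
  have h4 := sub_pos.2 hr
  have h5 : 0 < P.mu - r := by linarith
  have hψ := P.psi_pos
  have hS := h.Sp_pos
  rw [lowerLevel, div_le_iff₀ (by positivity)] at hl
  rw [upperLevel, lt_div_iff₀ (by positivity)] at hu
  by_cases hcase : P.Sp ≤ P.psi * (P.lamP + r) / (P.mu * (P.mu - (P.lamP + r)))
  · have hb : P.betaDynamic r = (P.mu - (P.lamP + r)) *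
        (P.mu * P.Sp * (P.mu - P.lamP) - P.psi * (P.lamP + r)) /
        (P.psi * (P.lamP + r) ^ 2 - P.mu * P.Sp * P.lamP * (P.mu - (P.lamP + r))) := by
      simp only [betaDynamic, if_pos hcase]
    rw [le_div_iff₀ (by positivity)] at hcase
    have hden : 0 < P.psi * (P.lamP + r) ^ 2
        - P.mu * P.Sp * P.lamP * (P.mu - (P.lamP + r)) := by
      have e1 := mul_le_mul_of_nonneg_left hcase h1.le
      have e2 : 0 < P.psi * (P.lamP + r) * r := by positivity
      nlinarith
    set x := P.betaDynamic r with hx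
    have hx0 : 0 ≤ x := by
      rw [hb]
      exact div_nonneg (mul_nonneg h4.le (by nlinarith)) hden.le
    have hx1 : x ≤ 1 := by
      rw [hb, div_le_one hden]
      nlinarith
    have hle : ENNReal.ofReal x ≤ 1 := by simpa using hx1
    rw [waitP_of_le_one hle, ENNReal.toReal_ofReal hx0]
    have h6 := sub_mul_pos h1.le h.lamP_lt_mu (y := 1 - x) (by linarith)
    rw [div_eq_iff (by positivity)]
    rw [eq_div_iff hden.ne'] at hb
    linear_combination hb
  · have hb : P.betaDynamic r = P.Sp * r * (P.mu - (P.lamP + r)) /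
        (P.psi * (P.lamP + r) - P.Sp * (P.mu - r) * (P.mu - (P.lamP + r))) := by
      simp only [betaDynamic, if_neg hcase]
    rw [not_le, div_lt_iff₀ (by positivity)] at hcase
    have hden : 0 < P.psi * (P.lamP + r) - P.Sp * (P.mu - r) * (P.mu - (P.lamP + r)) := by
      linarith
    set x := P.betaDynamic r with hx
    have hx1 : 1 < x := by
      rw [hb, one_lt_div hden]
      nlinarith
    have hx0 : 0 < x := by linarith
    have hlt : 1 < ENNReal.ofReal x := by simpa using hx1
    rw [waitP_of_one_lt hlt, ENNReal.toReal_inv, ENNReal.toReal_ofReal hx0.le]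
    have hxi : 0 < x⁻¹ := inv_pos.2 hx0
    have h6 := sub_mul_pos hr0.le (by linarith : r < P.mu) (y := 1 - x⁻¹) (by linarith)
    rw [div_eq_iff (by positivity)]
    rw [eq_div_iff hden.ne'] at hb
    have : x * x⁻¹ = 1 := mul_inv_cancel₀ hx0.ne'
    linear_combination x⁻¹ * hb -
      (P.psi * (P.lamP + r) - P.Sp * (P.mu - r) * (P.mu - (P.lamP + r))) * this

/-! ### Optimal rates and priorities -/

/-- The pair `(r, β)` is admissible, its priority is as high as the promise to the primary class
permits, and every admissible pair with another rate has a smaller value. -/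
structure IsBest (P : PricingModel) (r : ℝ) (β : ℝ≥0∞) : Prop where
  rate_pos : 0 < r
  stable : P.lamP + r < P.mu
  qos : P.waitP r β ≤ P.Sp
  active : P.waitP r β = P.Sp ∨ β = ⊤
  value_lt : ∀ s β', 0 ≤ s → P.lamP + s < P.mu → P.waitP s β' ≤ P.Sp → s ≠ r →
    P.value s β' < P.value r β

/-- The root of `G̃` maximizes the concave bound `valueStatic`, which static priority attains. -/
lemma isBest_of_Gtilde_eq_zero (h : P.Viable) {r : ℝ} (hr0 : 0 < r) (hr : P.lamP + r < P.mu)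
    (hG : P.Gtilde r = 0) (hu : P.upperLevel r ≤ P.Sp) : P.IsBest r ⊤ where
  rate_pos := hr0
  stable := hr
  qos := by rwa [waitP_top]
  active := Or.inr rfl
  value_lt s β' hs0 hs hβ' hne := by
    have h1 := h.lamP_pos
    rw [value_top h hr]
    exact (value_le_valueStatic h hs0 hs β').trans_lt
      (valueStatic_lt h (by linarith) (by linarith) hne (by simp [hG]))

/-- The two bounds agree at `rateStatic`, where static priority makes the primary constraint
active; the rate is best if `valueStatic` increases up to it and `valueActive` decreases from it
on. -/
lemma isBest_rateStatic (h : P.Viable) (hGt : P.Gtilde P.rateStatic ≤ 0)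
    (hG : 0 ≤ P.G P.rateStatic) : P.IsBest P.rateStatic ⊤ := by
  have h1 := h.lamP_pos
  obtain ⟨hr0, hr, hu⟩ := rateStatic_spec h
  have hw : P.waitP P.rateStatic ⊤ = P.Sp := by rw [waitP_top, hu]
  refine ⟨hr0, hr, hw.le, Or.inr rfl, fun s β' hs0 hs hβ' hne ↦ ?_⟩
  rcases hne.lt_or_gt with hlt | hlt
  · rw [value_top h hr]
    exact (value_le_valueStatic h hs0 hs β').trans_lt
      (valueStatic_lt h (by linarith) (by linarith) hne
        (mul_nonneg_of_nonpos_of_nonpos (by linarith) hGt))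
  · rw [value_eq_valueActive h hr0.le hr, hw, sub_self, mul_zero, sub_zero]
    exact (value_le_valueActive h hs0 hs hβ').trans_lt
      (valueActive_lt h hs hr hne (mul_nonneg (by linarith) hG))

lemma isBest_of_G_eq_zero (h : P.Viable) {r : ℝ} {β : ℝ≥0∞} (hr0 : 0 < r)
    (hr : P.lamP + r < P.mu) (hG : P.G r = 0) (hw : P.waitP r β = P.Sp) : P.IsBest r β where
  rate_pos := hr0
  stable := hr
  qos := hw.le
  active := Or.inl hw
  value_lt s β' hs0 hs hβ' hne := by
    rw [value_eq_valueActive h hr0.le hr, hw, sub_self, mul_zero, sub_zero]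
    exact (value_le_valueActive h hs0 hs hβ').trans_lt
      (valueActive_lt h hs hr hne (by simp [hG]))

/-- If `valueActive` is still increasing at the largest rate that static priority to the primary
class can accommodate, then that rate is best. -/
lemma isBest_zero (h : P.Viable) {r : ℝ} (hr0 : 0 < r) (hr : P.lamP + r < P.mu)
    (hG : P.G r ≤ 0) (hl : P.lowerLevel r = P.Sp) : P.IsBest r 0 where
  rate_pos := hr0
  stable := hr
  qos := by rw [waitP_bot h hr, hl]
  active := Or.inl (by rw [waitP_bot h hr, hl])
  value_lt s β' hs0 hs hβ' hne := by
    rw [value_eq_valueActive h hr0.le hr, waitP_bot h hr, hl, sub_self, mul_zero, sub_zero]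
    refine (value_le_valueActive h hs0 hs hβ').trans_lt (valueActive_lt h hs hr hne ?_)
    have hsr : s ≤ r := by
      by_contra! hlt
      have h1 := lowerLevel_le_waitP h (hr0.trans hlt) hs β'
      have h2 := lowerLevel_strictMono h hlt
      linarith
    exact mul_nonneg_of_nonpos_of_nonpos (by linarith) hG

/-- The last part of the algorithm returns a best pair. The sign condition on `G̃` says that
`S_p ≤ J_ℓ`, that is, that `valueStatic` increases up to `rateStatic`. -/
lemma exists_lateSteps (h : P.Viable) {Jl : EReal} (hJ : (P.Sp : EReal) ≤ Jl)
    (hGt : P.Gtilde P.rateStatic ≤ 0) :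
    ∃ z, P.lateSteps Jl = some z ∧ P.IsBest z.1 z.2 := by
  obtain ⟨hr0, hr, hu⟩ := rateStatic_spec h
  have h2 := h.mu_pos
  have h3 := sub_pos.2 h.lamP_lt_mu
  have hψ := P.psi_pos
  unfold lateSteps
  simp only [rate_test_iff h]
  by_cases hG0 : 0 ≤ P.G 0
  · rw [if_pos ⟨hG0, h.SpHat_lt_Sp, hJ⟩]
    exact ⟨_, rfl, isBest_rateStatic h hGt (G_pos_of_lt h hr0 hr hG0).le⟩
  · rw [if_neg (fun H ↦ hG0 H.1)]
    obtain ⟨r, hrI, hGr, hroot⟩ := exists_root_G h (not_le.1 hG0)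
    have hrμ : P.lamP + r < P.mu := by linarith [hrI.2]
    rw [hroot]
    dsimp only
    split_ifs with c1 c2 c3
    · refine ⟨_, rfl, ?_⟩
      dsimp only
      set m := P.mu * (P.mu - P.lamP) * P.Sp / P.psi - P.lamP with hm
      have hlm : P.lowerLevel m = P.Sp := by
        rw [lowerLevel, hm]; field_simp; ring
      have hl0 : P.lowerLevel 0 = P.SpHat := by
        rw [lowerLevel, SpHat]; ring_nf
      have hm0 : 0 < m := by
        rw [← (lowerLevel_strictMono h).lt_iff_lt, hl0, hlm]
        exact c1.1
      have hmr : m < r := by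
        rw [← (lowerLevel_strictMono h).lt_iff_lt, hlm]
        exact c1.2
      refine isBest_zero h hm0 (by linarith) ?_ hlm
      by_contra! hpos
      exact (G_pos_of_lt h hmr hrμ hpos.le).ne' hGr
    · exact ⟨_, rfl, isBest_of_G_eq_zero h hrI.1 hrμ hGr
        (waitP_betaDynamic h hrI.1 hrμ c2.1 c2.2)⟩
    · refine ⟨_, rfl, isBest_rateStatic h hGt ?_⟩
      have hle : r ≤ P.rateStatic := by
        by_contra! hlt
        have := upperLevel_lt_upperLevel h hr0.le hlt hrμ
        linarith [c3.1]
      rcases hle.eq_or_lt with heq | hlt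
      · rw [← heq, hGr]
      · exact (G_pos_of_lt h hlt hr hGr.ge).le
    · push Not at c1 c2 c3
      have e1 := c1 h.SpHat_lt_Sp
      have e2 := c2 e1
      exact absurd hJ (c3 e2).not_ge

lemma exists_ratePriority (h : P.Viable) :
    ∃ z, P.ratePriority = some z ∧ P.IsBest z.1 z.2 := by
  obtain ⟨hr0, hr, hu⟩ := rateStatic_spec h
  have h1 := h.lamP_pos
  unfold ratePriority
  rw [if_neg (not_or.2 ⟨h.SpHat_lt_Sp.not_ge, h.profitable.not_ge⟩)]
  simp only [capacity_test_iff h]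
  split_ifs with hcap
  · refine exists_lateSteps h le_top ?_
    by_contra! hpos
    exact hcap.not_gt (Gtilde_pos_of_lt h (by linarith) (by linarith) hpos.le)
  · obtain ⟨r, hrI, hGr, hroot⟩ := exists_root_Gtilde h (not_le.1 hcap)
    have hrμ : P.lamP + r < P.mu := by linarith [hrI.2]
    rw [hroot]
    dsimp only
    split_ifs with hJ
    · exact ⟨_, rfl, isBest_of_Gtilde_eq_zero h hrI.1 hrμ hGr hJ.le⟩
    · rw [not_lt] at hJ
      refine exists_lateSteps h (by exact_mod_cast hJ) ?_
      by_contra! hpos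
      have hle : P.rateStatic ≤ r := by
        by_contra! hlt
        have := upperLevel_lt_upperLevel h hrI.1.le hlt hr
        linarith
      rcases hle.eq_or_lt with heq | hlt
      · rw [heq, hGr] at hpos; exact hpos.false
      · exact (Gtilde_pos_of_lt h hlt (by linarith) hpos.le).ne' hGr

/-! ### Optimality and equilibrium -/

lemma Feasible.bounds {y : Profile} (hy : P.Feasible y) :
    P.lamP + y.lamS < P.mu ∧ P.waitP y.lamS y.beta ≤ P.Sp ∧
      P.waitS y.lamS y.beta ≤ y.Ss := by
  have h1 := hy.primary_qos
  have h2 := hy.secondary_qos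
  have hst : P.lamP + y.lamS < P.mu := by
    by_contra hst
    rw [Wp, if_neg hst] at h1
    exact absurd h1 (EReal.coe_lt_top _).not_ge
  rw [Wp, if_pos hst] at h1
  rw [Ws, if_pos hst] at h2
  exact ⟨hst, by exact_mod_cast h1, by exact_mod_cast h2⟩

lemma Feasible.revenue_le_value (h : P.Viable) {y : Profile} (hy : P.Feasible y) :
    P.b * revenue y ≤ P.value y.lamS y.beta := by
  have h1 := mul_le_mul_of_nonneg_left hy.bounds.2.2 h.c_pos.le
  have h2 := mul_le_mul_of_nonneg_left
    (by linarith [hy.demand] :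
      P.b * y.theta ≤ P.a - y.lamS - P.c * P.waitS y.lamS y.beta) hy.lamS_nonneg
  rw [revenue, value]
  linarith

/-- Some admissible small rate, served with static priority, has positive value. -/
lemma exists_value_pos (h : P.Viable) :
    ∃ s, 0 < s ∧ P.lamP + s < P.mu ∧ P.waitP s ⊤ ≤ P.Sp ∧ 0 < P.value s ⊤ := by
  obtain ⟨hr0, hr, hu⟩ := rateStatic_spec h
  have h1 := h.lamP_pos
  have h2 := h.mu_pos
  have hp := h.profitable
  rw [div_mul_eq_mul_div, div_lt_div_iff₀ (by positivity) h.c_pos] at hp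
  have hcont : ContinuousAt
      (fun s ↦ P.a - s - P.c * (P.psi * (P.lamP + s) / (P.mu * (P.mu - s)))) 0 := by
    have : P.mu * (P.mu - 0) ≠ 0 := by rw [sub_zero]; positivity
    fun_prop (disch := assumption)
  have hpos : 0 < P.a - 0 - P.c * (P.psi * (P.lamP + 0) / (P.mu * (P.mu - 0))) := by
    have : P.a - 0 - P.c * (P.psi * (P.lamP + 0) / (P.mu * (P.mu - 0))) =
        (P.a * P.mu ^ 2 - P.lamP * P.psi * P.c) / P.mu ^ 2 := by
      rw [sub_zero, sub_zero, add_zero]; field_simp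
    rw [this]
    exact div_pos (by linarith) (by positivity)
  have hev := (hcont.eventually (lt_mem_nhds hpos)).filter_mono
    (nhdsWithin_le_nhds (s := Set.Ioi 0))
  obtain ⟨s, hs, hs0, hsr⟩ := (hev.and (Ioo_mem_nhdsGT hr0)).exists
  have hsμ : P.lamP + s < P.mu := by linarith
  refine ⟨s, hs0, hsμ, ?_, ?_⟩
  · rw [waitP_top, ← hu]
    exact (upperLevel_lt_upperLevel h hs0.le hsr hr).le
  · rw [value_top h hsμ]
    have : P.valueStatic s =
        s * (P.a - s - P.c * (P.psi * (P.lamP + s) / (P.mu * (P.mu - s)))) := by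
      unfold valueStatic; ring
    rw [this]
    exact mul_pos hs0 hs

lemma IsBest.value_le (h : P.Viable) {r : ℝ} {β : ℝ≥0∞} (hb : P.IsBest r β) {s : ℝ} {β' : ℝ≥0∞}
    (hs0 : 0 ≤ s) (hs : P.lamP + s < P.mu) (hβ' : P.waitP s β' ≤ P.Sp) :
    P.value s β' ≤ P.value r β := by
  by_cases hne : s = r
  · subst hne
    refine value_le_value h hs0 hs ?_
    rcases hb.active with hw | rfl
    · rwa [hw]
    · rw [waitP_top]
      exact waitP_le_upperLevel h hb.rate_pos hs β'
  · exact (hb.value_lt s β' hs0 hs hβ' hne).le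

lemma IsBest.value_pos (h : P.Viable) {r : ℝ} {β : ℝ≥0∞} (hb : P.IsBest r β) :
    0 < P.value r β := by
  obtain ⟨s, hs0, hs, hw, hv⟩ := exists_value_pos h
  exact hv.trans_le (hb.value_le h hs0.le hs hw)

lemma IsBest.eq_of_value_eq (h : P.Viable) {r : ℝ} {β : ℝ≥0∞} (hb : P.IsBest r β) {s : ℝ}
    {β' : ℝ≥0∞} (hs0 : 0 ≤ s) (hs : P.lamP + s < P.mu) (hβ' : P.waitP s β' ≤ P.Sp)
    (heq : P.value s β' = P.value r β) : s = r ∧ β' = β := by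
  have hsr : s = r := by
    by_contra hne
    exact (hb.value_lt s β' hs0 hs hβ' hne).ne heq
  subst hsr
  refine ⟨rfl, (waitP_strictMono h hb.rate_pos hs).injective ?_⟩
  rw [value_eq_valueActive h hs0 hs, value_eq_valueActive h hs0 hs] at heq
  have hcl := mul_pos h.c_pos h.lamP_pos
  have := mul_left_cancel₀ hcl.ne' (sub_right_injective heq)
  linarith

lemma complete_eq {r : ℝ} {β : ℝ≥0∞} (hr : P.lamP + r < P.mu) :
    P.complete (r, β) = ⟨r, (P.a - P.c * P.waitS r β - r) / P.b, P.waitS r β, β⟩ := by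
  simp only [complete, Ws, if_pos hr, EReal.toReal_coe]

lemma IsBest.revenue_complete (h : P.Viable) {r : ℝ} {β : ℝ≥0∞} (hb : P.IsBest r β) :
    P.b * revenue (P.complete (r, β)) = P.value r β := by
  have := h.b_pos
  rw [complete_eq hb.stable, revenue, value]
  field_simp
  ring

lemma IsBest.feasible_complete (h : P.Viable) {r : ℝ} {β : ℝ≥0∞} (hb : P.IsBest r β) :
    P.Feasible (P.complete (r, β)) := by
  have hbp := h.b_pos
  have hv := hb.value_pos h
  have hpr : 0 < P.a - r - P.c * P.waitS r β := pos_of_mul_pos_right hv hb.rate_pos.le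
  rw [complete_eq hb.stable]
  refine ⟨?_, ?_, ?_, ?_, hb.rate_pos.le, ?_, waitS_nonneg h hb.rate_pos.le hb.stable β⟩
  · rw [Wp, if_pos hb.stable]
    exact_mod_cast hb.qos
  · rw [Ws, if_pos hb.stable]
  · linarith [hb.stable]
  · dsimp only
    rw [mul_div_cancel₀ _ hbp.ne']
    linarith
  · exact div_nonneg (by linarith) hbp.le

lemma IsBest.revenue_le (h : P.Viable) {r : ℝ} {β : ℝ≥0∞} (hb : P.IsBest r β) {y : Profile}
    (hy : P.Feasible y) : revenue y ≤ revenue (P.complete (r, β)) := by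
  refine le_of_mul_le_mul_left ?_ h.b_pos
  rw [hb.revenue_complete h]
  exact (hy.revenue_le_value h).trans
    (hb.value_le h hy.lamS_nonneg hy.bounds.1 hy.bounds.2.1)

/-- A feasible profile with the optimal revenue has the best rate and priority, and no slack in
the secondary constraint or in the demand. -/
lemma IsBest.eq_complete (h : P.Viable) {r : ℝ} {β : ℝ≥0∞} (hb : P.IsBest r β) {y : Profile}
    (hy : P.Feasible y) (hrev : revenue (P.complete (r, β)) ≤ revenue y) :
    y = P.complete (r, β) := by
  obtain ⟨hst, hwp, hws⟩ := hy.bounds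
  have hbp := h.b_pos
  have e1 := hy.revenue_le_value h
  have e2 := hb.value_le h hy.lamS_nonneg hst hwp
  have e3 := mul_le_mul_of_nonneg_left hrev hbp.le
  rw [hb.revenue_complete h] at e3
  obtain ⟨hr, hβ⟩ := hb.eq_of_value_eq h hy.lamS_nonneg hst hwp (by linarith)
  have hd := hy.demand
  have hcw := mul_le_mul_of_nonneg_left hws h.c_pos.le
  have hθ : y.lamS * (P.b * y.theta) = y.lamS *
      (P.a - y.lamS - P.c * P.waitS y.lamS y.beta) := by
    have : P.b * revenue y = P.value y.lamS y.beta := by linarith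
    rw [revenue, value] at this
    linarith
  have hy0 : 0 < y.lamS := hr ▸ hb.rate_pos
  have hθ' := mul_left_cancel₀ hy0.ne' hθ
  have hS : y.Ss = P.waitS y.lamS y.beta :=
    mul_left_cancel₀ h.c_pos.ne' (by linarith)
  rw [complete_eq hb.stable]
  ext
  · exact hr
  · rw [eq_div_iff hbp.ne', ← hr, ← hβ]
    linarith
  · rw [← hr, ← hβ]; exact hS
  · exact hβ

lemma IsNash.feasible {y : Profile} (hy : P.IsNash y) : P.Feasible y :=
  ⟨hy.1.1.primary_qos, hy.1.1.secondary_qos, hy.1.1.stability, hy.1.1.demand, hy.2.1.1,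
    hy.1.1.theta_nonneg, hy.1.1.Ss_nonneg⟩

lemma IsBest.isNash_complete (h : P.Viable) {r : ℝ} {β : ℝ≥0∞} (hb : P.IsBest r β) :
    P.IsNash (P.complete (r, β)) := by
  have hf := hb.feasible_complete h
  refine ⟨⟨⟨hf.primary_qos, hf.secondary_qos, hf.stability, hf.demand, hf.theta_nonneg,
    hf.Ss_nonneg⟩, fun θ' S' β' hp ↦ ?_⟩, ⟨hf.lamS_nonneg, hf.demand⟩, fun s hs ↦ ?_⟩
  · exact hb.revenue_le h (y := ⟨(P.complete (r, β)).lamS, θ', S', β'⟩)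
      ⟨hp.primary_qos, hp.secondary_qos, hp.stability, hp.demand, hf.lamS_nonneg,
        hp.theta_nonneg, hp.Ss_nonneg⟩
  · -- The price of `complete` leaves no slack in the demand.
    have := hs.2
    rw [complete_eq hb.stable] at this ⊢
    dsimp only at this ⊢
    rw [mul_div_cancel₀ _ h.b_pos.ne'] at this
    linarith

end PricingModel

theorem theorem3 (P : PricingModel)
    (hlamP : 0 < P.lamP) (hmu : P.lamP < P.mu) (hsigma : 0 ≤ P.sigma)
    (ha : 0 < P.a) (hb : 0 < P.b) (hc : 0 < P.c)
    (hSp : P.lamP * P.psi / (P.mu * (P.mu - P.lamP)) < P.Sp)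
    (hac : P.lamP / P.mu ^ 2 * P.psi < P.a / P.c) :
    ∃ x : Profile,
      P.algorithm = some x ∧
      P.IsSolution x ∧ (∀ y : Profile, P.IsSolution y → y = x) ∧
      P.IsNash x ∧
      (∀ y : Profile, P.IsNash y →
        PricingModel.revenue y ≤ PricingModel.revenue x) := by
  have h : P.Viable := ⟨hlamP, hmu, hb, hc, hSp, hac⟩
  obtain ⟨⟨r, β⟩, hz, hbest⟩ := PricingModel.exists_ratePriority h
  have hf := hbest.feasible_complete h
  refine ⟨P.complete (r, β), by rw [PricingModel.algorithm, hz]; rfl,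
    ⟨hf, fun y hy ↦ hbest.revenue_le h hy⟩,
    fun y hy ↦ hbest.eq_complete h hy.1 (hy.2 _ hf), hbest.isNash_complete h,
    fun y hy ↦ hbest.revenue_le h hy.feasible⟩
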